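/- For graphs $H_1,H_2$, let the Ramsey number $R(H_1,H_2)$ be the smallest integer $N$ such that every graph $G$ with $N$ vertices contains $H_1$ as a (not necessarily induced) subgraph or has a complement $\overline{G}$ that contains $H_2$ as a subgraph. Let $C_4$ be the cycle on $4$ vertices, let $K_{1,n}$ be the star with $n$ leaves, and put $f(n)=R(C_4,K_{1,n})$. Then $$f(51)\ge 59,\quad f(52)\ge 60,\quad f(53)\ge 61,\quad f(69)\ge 78,\quad f(71)\ge 80,$$ $$f(102)\le 113,\quad f(104)\le 115,\quad f(106)\le 117,\quad f(108)\le 119.$$ -/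

import Mathlib

open SimpleGraph

/-- `IsRamsey H₁ H₂ N`: every graph `G` of order `N` contains `H₁` as a (not necessarily
induced) subgraph, or its complement contains `H₂`. -/
def IsRamsey {α β : Type*} (H₁ : SimpleGraph α) (H₂ : SimpleGraph β) (N : ℕ) : Prop :=
  ∀ G : SimpleGraph (Fin N), H₁.IsContained G ∨ H₂.IsContained Gᶜ

/-- The Ramsey number `R(H₁, H₂)`: the smallest `N` such that every graph of order `N` contains
`H₁` or has a complement containing `H₂`. -/
noncomputable def ramseyNumber {α β : Type*} (H₁ : SimpleGraph α) (H₂ : SimpleGraph β) : ℕ :=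
  sInf {N : ℕ | IsRamsey H₁ H₂ N}

/-- The star `K_{1,n}`, with `n` leaves. -/
abbrev starK (n : ℕ) : SimpleGraph (Fin 1 ⊕ Fin n) := completeBipartiteGraph (Fin 1) (Fin n)

/-- `f(n) = R(C₄, K_{1,n})`. -/
noncomputable def ramseyC4Star (n : ℕ) : ℕ := ramseyNumber (cycleGraph 4) (starK n)

/-- A vertex of degree at least `n` is the centre of a `K_{1,n}`. -/
theorem starK_isContained {V : Type*} [Fintype V] (G : SimpleGraph V) [DecidableRel G.Adj]
    (v : V) (n : ℕ) (h : n ≤ G.degree v) : (starK n).IsContained G := by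
  classical
  have hc : Fintype.card (Fin n) ≤ Fintype.card (G.neighborFinset v) := by
    rw [Fintype.card_fin, Fintype.card_coe, card_neighborFinset_eq_degree]
    exact h
  obtain ⟨e⟩ := Function.Embedding.nonempty_of_card_le hc
  have he : ∀ i, G.Adj v (e i) := fun i => (G.mem_neighborFinset v _).1 (e i).2
  refine ⟨⟨⟨Sum.elim (fun _ => v) (fun i => (e i : V)), ?_⟩, ?_⟩⟩
  · rintro (a | a) (b | b) hab
    · simp at hab
    · exact he b
    · exact (he a).symm
    · simp at hab
  · rintro (a | a) (b | b) hab
    · exact congrArg _ (Subsingleton.elim a b)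
    · exact absurd hab (he b).ne
    · exact absurd hab (he a).ne'
    · exact congrArg _ (e.injective (Subtype.ext hab))

/-- Two distinct vertices with two common neighbours give a `C₄`. -/
theorem cycleGraph_four_isContained {V : Type*} (G : SimpleGraph V) {u v x y : V}
    (huv : u ≠ v) (hxy : x ≠ y) (hux : G.Adj u x) (hvx : G.Adj v x)
    (huy : G.Adj u y) (hvy : G.Adj v y) : (cycleGraph 4).IsContained G := by
  refine ⟨⟨⟨![u, x, v, y], ?_⟩, ?_⟩⟩
  · intro a b hab
    rw [cycleGraph_adj] at hab
    fin_cases a <;> fin_cases b <;>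
      first
      | exact hux
      | exact hux.symm
      | exact hvx
      | exact hvx.symm
      | exact huy
      | exact huy.symm
      | exact hvy
      | exact hvy.symm
      | exact absurd hab (by decide)
  · intro a b hab
    have h1 := hux.ne
    have h2 := hvx.ne
    have h3 := huy.ne
    have h4 := hvy.ne
    fin_cases a <;> fin_cases b <;> simp_all

/-- `2n + 2` has the Ramsey property for `(C₄, K_{1,n})`, so `f(n)` is an honest minimum. -/
theorem isRamsey_C4_star (n : ℕ) : IsRamsey (cycleGraph 4) (starK n) (2 * n + 2) := by
  classical
  intro G
  by_cases h : ∃ v, n ≤ Gᶜ.degree v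
  · obtain ⟨v, hv⟩ := h
    exact Or.inr (starK_isContained _ v n hv)
  left
  push Not at h
  let u : Fin (2 * n + 2) := ⟨0, by omega⟩
  let v : Fin (2 * n + 2) := ⟨1, by omega⟩
  have huv : u ≠ v := by simp [u, v]
  have hu := h u
  have hv := h v
  rw [degree_compl, Fintype.card_fin] at hu hv
  have hi := Finset.card_union_add_card_inter (G.neighborFinset u) (G.neighborFinset v)
  have hle : (G.neighborFinset u ∪ G.neighborFinset v).card ≤ 2 * n + 2 := by
    simpa using Finset.card_le_univ (G.neighborFinset u ∪ G.neighborFinset v)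
  rw [card_neighborFinset_eq_degree, card_neighborFinset_eq_degree] at hi
  have h2 : 1 < (G.neighborFinset u ∩ G.neighborFinset v).card := by omega
  obtain ⟨x, hx, y, hy, hxy⟩ := Finset.one_lt_card.1 h2
  simp only [Finset.mem_inter, mem_neighborFinset] at hx hy
  exact cycleGraph_four_isContained G huv hxy hx.1 hx.2 hy.1 hy.2

/-- `f(n)` is the least element of the set of orders with the Ramsey property. -/
theorem isLeast_ramseyC4Star (n : ℕ) :
    IsLeast {N : ℕ | IsRamsey (cycleGraph 4) (starK n) N} (ramseyC4Star n) :=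
  ⟨Nat.sInf_mem ⟨_, isRamsey_C4_star n⟩, fun _ h => Nat.sInf_le h⟩

/-!
A graph of order `N` shows `N < R(C₄, K_{1,n})` exactly when it is `C₄`-free with minimum degree
at least `N - n`.

**Lower bounds.** If `D ⊆ ℤ/m` is a Sidon set, the graph on `ℤ/m` joining distinct `i`, `j` with
`i + j ∈ D` is `C₄`-free. For the perfect difference sets with `m = q² + q + 1` and `|D| = q + 1`
this is the polarity graph of a projective plane of order `q`, in which two distinct vertices have
exactly one common polar neighbour. Deleting a closed neighbourhood therefore costs each remaining
vertex at most one neighbour, and further vertices on a line through the deleted part can be removed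
so that no vertex drops below the degree required. With `q = 8` this gives orders `58`, `59`, `60`
and minimum degree `7`, with `q = 9` orders `77`, `79` and minimum degree `8`; the degree conditions
are finite checks (`not_isRamsey_of_sidon`).

**Upper bounds.** In a `C₄`-free graph of order `N` the sets `N(w) \ {v}`, for `w` adjacent to `v`,
are disjoint subsets of the `N - 1` vertices other than `v`. If all degrees are at least `d`, then
`deg v * (d - 1) ≤ N - 1`, so for `N < d²` the graph is `d`-regular, which is impossible when `N`
and `d` are both odd (`isRamsey_of_odd`). All four upper bounds are the case `d = 11`.
-/

/-! ### Ramsey numbers and minimum degrees -/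

theorem isRamsey_mono {α β : Type*} {H₁ : SimpleGraph α} {H₂ : SimpleGraph β} {M N : ℕ}
    (hMN : M ≤ N) (h : IsRamsey H₁ H₂ M) : IsRamsey H₁ H₂ N := by
  intro G
  let e : Fin M ↪ Fin N := Fin.castLEEmb hMN
  rcases h (G.comap e) with h | h
  · exact Or.inl (h.trans ⟨⟨⟨e, fun h => h⟩, e.injective⟩⟩)
  · refine Or.inr (h.trans ⟨⟨⟨e, fun {a b} hab => ?_⟩, e.injective⟩⟩)
    rw [compl_adj] at hab ⊢
    exact ⟨fun h => hab.1 (e.injective h), hab.2⟩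

theorem lt_ramseyC4Star {n N : ℕ} (h : ¬ IsRamsey (cycleGraph 4) (starK n) N) :
    N < ramseyC4Star n := by
  by_contra! hN
  exact h (isRamsey_mono hN (isLeast_ramseyC4Star n).1)

/-- The subgraph of `H` induced on `T` witnesses the failure of the Ramsey property: a star with
`n` leaves in its complement would need `n` non-neighbours of the centre in `T`. -/
theorem not_isRamsey_of_induced {V : Type*} [DecidableEq V] (H : SimpleGraph V)
    [DecidableRel H.Adj] (hH : ¬ (cycleGraph 4).IsContained H) (T : Finset V) {n d : ℕ}
    (hd : ∀ v ∈ T, d ≤ {w ∈ T | H.Adj v w}.card) (hT : T.card ≤ n + d) :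
    ¬ IsRamsey (cycleGraph 4) (starK n) T.card := by
  intro h
  let e : Fin T.card ↪ V := T.equivFin.symm.toEmbedding.trans (Function.Embedding.subtype _)
  have heT : ∀ i, e i ∈ T := fun i => (T.equivFin.symm i).2
  rcases h (H.comap e) with h | ⟨⟨f, hf⟩⟩
  · exact hH (h.trans ⟨⟨⟨e, fun h => h⟩, e.injective⟩⟩)
  set v := e (f (Sum.inl 0)) with hv
  let g : Fin n ↪ V := ⟨fun i => e (f (Sum.inr i)),
    fun i j hij => Sum.inr_injective (hf (e.injective hij))⟩
  have hadj : ∀ i, (H.comap e)ᶜ.Adj (f (Sum.inl 0)) (f (Sum.inr i)) := fun i =>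
    f.map_adj (by simp [starK])
  have hdisj : Disjoint (Finset.univ.map g) {w ∈ T | H.Adj v w} := by
    rw [Finset.disjoint_left]
    intro w hw hw'
    obtain ⟨i, -, rfl⟩ := Finset.mem_map.1 hw
    exact ((compl_adj _ _ _).1 (hadj i)).2 (Finset.mem_filter.1 hw').2
  have hsub : Finset.univ.map g ∪ {w ∈ T | H.Adj v w} ⊆ T.erase v := by
    intro w hw
    rw [Finset.mem_erase]
    rcases Finset.mem_union.1 hw with hw | hw
    · obtain ⟨i, -, rfl⟩ := Finset.mem_map.1 hw
      exact ⟨fun h => (hadj i).ne (e.injective h.symm), heT _⟩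
    · have hw := Finset.mem_filter.1 hw
      exact ⟨hw.2.ne', hw.1⟩
  have hcard := Finset.card_le_card hsub
  rw [Finset.card_union_of_disjoint hdisj, Finset.card_map, Finset.card_univ, Fintype.card_fin,
    Finset.card_erase_of_mem (heT _)] at hcard
  have hpos : 0 < T.card := Finset.card_pos.2 ⟨v, heT _⟩
  have := hd v (heT _)
  omega

/-! ### Sum graphs of Sidon sets -/

/-- The graph on an abelian group in which distinct `i`, `j` are adjacent when `i + j ∈ D`. -/
def sumGraph {A : Type*} [AddCommGroup A] (D : Finset A) : SimpleGraph A where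
  Adj i j := i ≠ j ∧ i + j ∈ D
  symm := ⟨fun i j h => ⟨h.1.symm, add_comm i j ▸ h.2⟩⟩
  loopless := ⟨fun _ h => h.1 rfl⟩

instance {A : Type*} [AddCommGroup A] [DecidableEq A] (D : Finset A) :
    DecidableRel (sumGraph D).Adj :=
  fun i j => inferInstanceAs (Decidable (i ≠ j ∧ i + j ∈ D))

/-- Along a four-cycle the consecutive edge sums `s₀, s₁, s₂, s₃` satisfy `s₀ + s₂ = s₁ + s₃`, so
the Sidon property makes two opposite vertices of the cycle equal. -/
theorem not_isContained_sumGraph {A : Type*} [AddCommGroup A] (D : Finset A)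
    (hD : ∀ a ∈ D, ∀ b ∈ D, ∀ c ∈ D, ∀ d ∈ D, a + b = c + d → a = c ∨ a = d) :
    ¬ (cycleGraph 4).IsContained (sumGraph D) := by
  rintro ⟨⟨f, hf⟩⟩
  have h01 := (f.map_adj (show (cycleGraph 4).Adj 0 1 by rw [cycleGraph_adj]; decide)).2
  have h12 := (f.map_adj (show (cycleGraph 4).Adj 1 2 by rw [cycleGraph_adj]; decide)).2
  have h23 := (f.map_adj (show (cycleGraph 4).Adj 2 3 by rw [cycleGraph_adj]; decide)).2
  have h30 := (f.map_adj (show (cycleGraph 4).Adj 3 0 by rw [cycleGraph_adj]; decide)).2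
  rcases hD _ h01 _ h23 _ h12 _ h30 (by abel) with h | h
  · rw [add_comm (f 1)] at h
    exact absurd (hf (add_right_cancel h)) (by decide)
  · rw [add_comm (f 3)] at h
    exact absurd (hf (add_left_cancel h)) (by decide)

theorem not_isRamsey_of_sidon {A : Type*} [AddCommGroup A] [DecidableEq A] (D T : Finset A)
    {n d N : ℕ} (hD : ∀ a ∈ D, ∀ b ∈ D, ∀ c ∈ D, ∀ d ∈ D, a + b = c + d → a = c ∨ a = d)
    (hT : T.card = N) (hd : ∀ v ∈ T, d ≤ {w ∈ T | (sumGraph D).Adj v w}.card)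
    (hN : N ≤ n + d) : ¬ IsRamsey (cycleGraph 4) (starK n) N := by
  subst hT
  exact not_isRamsey_of_induced (sumGraph D) (not_isContained_sumGraph D hD) T hd hN

/-- A perfect difference set of order `8`. -/
def diffSet73 : Finset (ZMod 73) := {0, 1, 3, 7, 15, 31, 36, 54, 63}

/-- A perfect difference set of order `9`. -/
def diffSet91 : Finset (ZMod 91) := {0, 1, 3, 9, 27, 49, 56, 61, 77, 81}

/-- The vertex `36` of the polarity graph of `diffSet73` together with its neighbours, which are the
nine absolute points `i`, those with `i + i ∈ diffSet73`. The graph left after deleting them is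
`8`-regular of order `63`. -/
def absolute73 : Finset (ZMod 73) := {36, 0, 18, 27, 37, 38, 40, 44, 52, 68}

theorem sidon_diffSet73 : ∀ a ∈ diffSet73, ∀ b ∈ diffSet73, ∀ c ∈ diffSet73, ∀ d ∈ diffSet73,
    a + b = c + d → a = c ∨ a = d := by
  decide +kernel

theorem sidon_diffSet91 : ∀ a ∈ diffSet91, ∀ b ∈ diffSet91, ∀ c ∈ diffSet91, ∀ d ∈ diffSet91,
    a + b = c + d → a = c ∨ a = d := by
  decide +kernel

-- The common neighbour of any two of `1, 3, 7, 15, 31` is the deleted vertex `0`, so each remaining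
-- vertex is adjacent to at most one of them.
theorem not_isRamsey_51 : ¬ IsRamsey (cycleGraph 4) (starK 51) 58 :=
  not_isRamsey_of_sidon diffSet73 (absolute73 ∪ {1, 3, 7, 15, 31})ᶜ (d := 7) sidon_diffSet73
    (by decide +kernel) (by decide +kernel) (by norm_num)

theorem not_isRamsey_52 : ¬ IsRamsey (cycleGraph 4) (starK 52) 59 :=
  not_isRamsey_of_sidon diffSet73 (absolute73 ∪ {1, 3, 7, 15})ᶜ (d := 7) sidon_diffSet73
    (by decide +kernel) (by decide +kernel) (by norm_num)

theorem not_isRamsey_53 : ¬ IsRamsey (cycleGraph 4) (starK 53) 60 :=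
  not_isRamsey_of_sidon diffSet73 (absolute73 ∪ {1, 3, 7})ᶜ (d := 7) sidon_diffSet73
    (by decide +kernel) (by decide +kernel) (by norm_num)

-- `diffSet91` is also the closed neighbourhood of the vertex `0`, and `26, 55, 60, 76` are
-- neighbours of the deleted vertex `1`, so no remaining vertex is adjacent to two of them.
theorem not_isRamsey_69 : ¬ IsRamsey (cycleGraph 4) (starK 69) 77 :=
  not_isRamsey_of_sidon diffSet91 (diffSet91 ∪ {26, 55, 60, 76})ᶜ (d := 8) sidon_diffSet91
    (by decide +kernel) (by decide +kernel) (by norm_num)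

theorem not_isRamsey_71 : ¬ IsRamsey (cycleGraph 4) (starK 71) 79 :=
  not_isRamsey_of_sidon diffSet91 (diffSet91 ∪ {26, 55})ᶜ (d := 8) sidon_diffSet91
    (by decide +kernel) (by decide +kernel) (by norm_num)

/-! ### Odd order and odd minimum degree -/

/-- In a `C₄`-free graph the sets `N(w) \ {v}`, for `w` adjacent to `v`, are disjoint. -/
theorem degree_mul_le_of_not_isContained {V : Type*} [Fintype V] [DecidableEq V]
    (G : SimpleGraph V) [DecidableRel G.Adj] (hG : ¬ (cycleGraph 4).IsContained G) {d : ℕ}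
    (hd : ∀ v, d ≤ G.degree v) (v : V) : G.degree v * (d - 1) ≤ Fintype.card V - 1 := by
  have hdisj : (G.neighborFinset v : Set V).PairwiseDisjoint
      fun w => (G.neighborFinset w).erase v := by
    intro x hx y hy hxy
    rw [Function.onFun, Finset.disjoint_left]
    intro u hux huy
    simp only [Finset.mem_coe, Finset.mem_erase, mem_neighborFinset]
      at hx hy hux huy
    exact hG (cycleGraph_four_isContained G hux.1.symm hxy hx hux.2.symm hy huy.2.symm)
  calc G.degree v * (d - 1)
      ≤ ∑ w ∈ G.neighborFinset v, ((G.neighborFinset w).erase v).card := by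
        rw [← card_neighborFinset_eq_degree, ← smul_eq_mul]
        refine Finset.card_nsmul_le_sum _ _ _ fun w hw => ?_
        rw [Finset.card_erase_of_mem
          ((G.mem_neighborFinset w v).2 ((G.mem_neighborFinset v w).1 hw).symm),
          card_neighborFinset_eq_degree]
        exact Nat.sub_le_sub_right (hd w) 1
    _ = ((G.neighborFinset v).biUnion fun w => (G.neighborFinset w).erase v).card :=
        (Finset.card_biUnion hdisj).symm
    _ ≤ (Finset.univ.erase v).card := by
        refine Finset.card_le_card fun u hu => ?_
        obtain ⟨w, -, hw⟩ := Finset.mem_biUnion.1 hu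
        exact Finset.mem_erase.2 ⟨(Finset.mem_erase.1 hw).1, Finset.mem_univ u⟩
    _ = Fintype.card V - 1 := by
        rw [Finset.card_erase_of_mem (Finset.mem_univ v), Finset.card_univ]

theorem isRamsey_of_odd {n d N : ℕ} (hN : Odd N) (hd : Odd d) (hlt : N < d ^ 2)
    (hnd : n + d = N) : IsRamsey (cycleGraph 4) (starK n) N := by
  classical
  intro G
  by_contra hG
  rw [not_or] at hG
  have hdeg : ∀ v, d ≤ G.degree v := by
    intro v
    by_contra! hv
    refine hG.2 (starK_isContained _ v n ?_)
    rw [degree_compl, Fintype.card_fin]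
    omega
  have hreg : ∀ v, G.degree v = d := by
    intro v
    refine le_antisymm ?_ (hdeg v)
    by_contra! hv
    have h := degree_mul_le_of_not_isContained G hG.1 hdeg v
    rw [Fintype.card_fin] at h
    obtain ⟨k, rfl⟩ := hd
    have h' := (Nat.mul_le_mul_right (2 * k + 1 - 1) hv).trans h
    have hpos := hN.pos
    rw [Nat.add_sub_cancel] at h'
    zify [hpos] at h' hlt
    nlinarith
  have hsum := G.sum_degrees_eq_twice_card_edges
  simp only [hreg, Finset.sum_const, Finset.card_univ, Fintype.card_fin, smul_eq_mul] at hsum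
  exact Nat.not_even_iff_odd.2 (hN.mul hd) (hsum ▸ even_two_mul _)

theorem ramseyC4Star_le_of_odd {n d N : ℕ} (hN : Odd N) (hd : Odd d) (hlt : N < d ^ 2)
    (hnd : n + d = N) : ramseyC4Star n ≤ N :=
  (isLeast_ramseyC4Star n).2 (isRamsey_of_odd hN hd hlt hnd)

theorem mainTheorem5 :
    59 ≤ ramseyC4Star 51 ∧ 60 ≤ ramseyC4Star 52 ∧ 61 ≤ ramseyC4Star 53 ∧
    78 ≤ ramseyC4Star 69 ∧ 80 ≤ ramseyC4Star 71 ∧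
    ramseyC4Star 102 ≤ 113 ∧ ramseyC4Star 104 ≤ 115 ∧
    ramseyC4Star 106 ≤ 117 ∧ ramseyC4Star 108 ≤ 119 := by
  refine ⟨lt_ramseyC4Star not_isRamsey_51, lt_ramseyC4Star not_isRamsey_52,
    lt_ramseyC4Star not_isRamsey_53, lt_ramseyC4Star not_isRamsey_69,
    lt_ramseyC4Star not_isRamsey_71, ?_, ?_, ?_, ?_⟩ <;>
  exact ramseyC4Star_le_of_odd (d := 11) (by decide) (by decide) (by norm_num) (by norm_num)
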